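/- Let $\Lambda J$ be the calculus with generalized applications: terms $t,u,r ::= x \mid \lambda x.t \mid t(u,y.r)$ (modulo $\alpha$-equivalence, $y$ bound in $r$), with the rules, closed under all contexts, $$(\lambda x.t)(u,y.r)\to_\beta \{\{u/x\}t/y\}r,\qquad t(u,x.r)(u',y.r')\to_\pi t(u,x.\,r(u',y.r'))\quad (x\notin \mathrm{fv}(u')\cup\mathrm{fv}(\lambda y.r')).$$ A term is $(\beta,\pi)$-strongly normalizing if it starts no infinite sequence of $\beta$- and $\pi$-steps. Types are $\sigma,\tau ::= a \mid \mathcal M\to\sigma$, where $a$ ranges over a countably infinite set of base types and $\mathcal M$ over finite multisets $[\sigma_i]_{i\in I}$ of types. Environments $\Gamma$ map variables to multisets of types, with $[\,]$ for all but finitely many variables, and $\Gamma\wedge\Delta$ is the pointwise multiset union. $\#(\mathcal M)$ denotes $\mathcal M$ if $\mathcal M\ne[\,]$, and $[\sigma]$ for an arbitrary type $\sigma$ if $\mathcal M=[\,]$. The rules of the system $\cap J$ are * (var) $x:[\sigma]\vdash x:\sigma$; * (abs) from $\Gamma;x:\mathcal M\vdash t:\sigma$ infer $\Gamma\vdash\lambda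 x.t:\mathcal M\to\sigma$; * (many) from $\Gamma_i\vdash t:\sigma_i$ for all $i\in I$, with $I$ finite and non-empty, infer $\bigwedge_{i\in I}\Gamma_i\vdash t:[\sigma_i]_{i\in I}$; * (app) from $\Gamma\vdash t:\#([\mathcal M_i\to\tau_i]_{i\in I})$, $\Delta\vdash u:\#(\sqcup_{i\in I}\mathcal M_i)$ and $\Lambda;y:[\tau_i]_{i\in I}\vdash r:\sigma$, with $I$ finite and possibly empty, infer $\Gamma\wedge\Delta\wedge\Lambda\vdash t(u,y.r):\sigma$. The size of a derivation is the number of its rule instances other than (many); $\Gamma\vdash^k t:\sigma$ means that $\Gamma\vdash t:\sigma$ has a derivation of size $k$. A term $t$ is $\cap J$-typable if $\Gamma\vdash^k t:\sigma$ for some $\Gamma$, $\sigma$, $k$. Then: 1. If $\Gamma\vdash^k t:\sigma$, then every $(\beta,\pi)$-reduction sequence starting at $t$ contains at most $k$ $\beta$-steps, and $t$ is $(\beta,\pi)$-strongly normalizing. 2. Quantitative subject reduction fails for $\pi$, both for the environment and for the size. There are $\Gamma,\sigma,k$ and a step $t\to_\pi t'$ such that $\Gamma\vdash^k t:\sigma$,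 while $\Gamma\vdash t':\sigma$ is not derivable. There are also $\Gamma,\sigma,k$ and a step $t\to_\pi t'$ such that $\Gamma\vdash^k t:\sigma$, while no derivation for $t'$, of any type in any environment, has size less than $k$. 3. A term is $(\beta,\pi)$-strongly normalizing in $\Lambda J$ if and only if it is $\cap J$-typable. Hence, by 1, the size of any derivation for a strongly normalizing term bounds the number of $\beta$-steps of its $(\beta,\pi)$-reduction sequences. -/

import Mathlib

/-! The calculus `ΛJ` of generalized applications, in de Bruijn notation, and the
non-idempotent intersection type system `∩J`. -/

namespace GenApp

/-! ### Terms -/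

/-- Terms up to `α`-equivalence. `app t u r` is the generalized application `t(u, y.r)`;
the variable `y` is index `0` in `r`, and index `0` of `t` is the bound variable in `lam t`. -/
inductive Term : Type
  | var (n : ℕ)
  | lam (t : Term)
  | app (t u r : Term)

namespace Term

/-- Extension of a renaming under a binder. -/
def upRen (ρ : ℕ → ℕ) : ℕ → ℕ
  | 0 => 0
  | n + 1 => ρ n + 1

/-- Renaming of free variables. -/
def rename : (ℕ → ℕ) → Term → Term
  | ρ, var n => var (ρ n)
  | ρ, lam t => lam (rename (upRen ρ) t)
  | ρ, app t u r => app (rename ρ t) (rename ρ u) (rename (upRen ρ) r)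

/-- Extension of a simultaneous substitution under a binder. -/
def upSub (θ : ℕ → Term) : ℕ → Term
  | 0 => var 0
  | n + 1 => rename Nat.succ (θ n)

/-- Simultaneous capture-avoiding substitution. -/
def subst : (ℕ → Term) → Term → Term
  | θ, var n => θ n
  | θ, lam t => lam (subst (upSub θ) t)
  | θ, app t u r => app (subst θ t) (subst θ u) (subst (upSub θ) r)

/-- `inst u t` is `{u/x}t`, where `x` is the variable with index `0` in `t`. -/
def inst (u t : Term) : Term :=
  subst (fun n => match n with
    | 0 => u
    | m + 1 => var m) t

end Term

open Term

/-! ### Reduction -/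

/-- The root rule `(λx.t)(u, y.r) ↦ {{u/x}t/y}r`. -/
inductive BetaRoot : Term → Term → Prop
  | mk (t u r : Term) : BetaRoot (app (lam t) u r) (inst (inst u t) r)

/-- The root rule `t(u, x.r)(u', y.r') ↦ t(u, x.r(u', y.r'))`, where `x` is not free in `u'`, `r'`:
both are weakened by `x`, which lies below the binder `y` in `r'`. -/
inductive PiRoot : Term → Term → Prop
  | mk (t u r u' r' : Term) :
      PiRoot (app (app t u r) u' r')
        (app t u (app r (rename Nat.succ u') (rename (upRen Nat.succ) r')))

/-- Closure of a relation under all term contexts. -/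
inductive Compat (R : Term → Term → Prop) : Term → Term → Prop
  | root {t t' : Term} : R t t' → Compat R t t'
  | lam {t t' : Term} : Compat R t t' → Compat R (lam t) (lam t')
  | appFun {t t' : Term} (u r : Term) : Compat R t t' → Compat R (app t u r) (app t' u r)
  | appArg (t : Term) {u u' : Term} (r : Term) : Compat R u u' → Compat R (app t u r) (app t u' r)
  | appBody (t u : Term) {r r' : Term} : Compat R r r' → Compat R (app t u r) (app t u r')

/-- One-step `β`-reduction. -/
def BetaStep : Term → Term → Prop := Compat BetaRoot

/-- One-step `π`-reduction. -/
def PiStep : Term → Term → Prop := Compat PiRoot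

/-- `RedSeq t n t'`: there is a finite `(β,π)`-reduction sequence from `t` to `t'` which contains
exactly `n` `β`-steps (and any number of `π`-steps). -/
inductive RedSeq : Term → ℕ → Term → Prop
  | nil (t : Term) : RedSeq t 0 t
  | beta {t t₁ t' : Term} {n : ℕ} : BetaStep t t₁ → RedSeq t₁ n t' → RedSeq t (n + 1) t'
  | pi {t t₁ t' : Term} {n : ℕ} : PiStep t t₁ → RedSeq t₁ n t' → RedSeq t n t'

/-- `(β,π)`-strong normalization: there is no infinite `(β,π)`-reduction sequence from `t`. -/
def SN (t : Term) : Prop :=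
  ¬ ∃ f : ℕ → Term, f 0 = t ∧ ∀ n, BetaStep (f n) (f (n + 1)) ∨ PiStep (f n) (f (n + 1))

/-! ### Types

Types are generated by `σ ::= a | M → σ`, where `a` ranges over a countably infinite set of base
types and `M` over finite multisets of types. As an inductive type may not recurse through
`Multiset`, we take the initial algebra of the functor `X ↦ ℕ ⊕ (Multiset X × X)`. -/

/-- The functor `X ↦ ℕ ⊕ (Multiset X × X)` that generates the types. -/
def TyF (X : Type) : Type := ℕ ⊕ (Multiset X × X)

/-- The action of `TyF` on functions. -/
def TyF.map {X Y : Type} (f : X → Y) : TyF X → TyF Y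
  | Sum.inl a => Sum.inl a
  | Sum.inr p => Sum.inr (p.1.map f, f p.2)

instance : Functor TyF where
  map := TyF.map

/-- The polynomial functor `X ↦ ℕ ⊕ ((Σ n, Fin n → X) × X)`, of which `TyF` is a quotient. -/
def TyP : PFunctor.{0, 0} where
  A := ℕ ⊕ ℕ
  B := Sum.elim (fun _ => Empty) (fun n => Option (Fin n))

/-- The quotient map from `TyP` to `TyF`, which forgets the order of the entries. -/
def TyP.abs {X : Type} : TyP X → TyF X
  | ⟨Sum.inl a, _⟩ => Sum.inl a
  | ⟨Sum.inr n, f⟩ => Sum.inr (Finset.univ.val.map (fun i : Fin n => f (some i)), f none)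

theorem TyP.abs_surjective {X : Type} (x : TyF X) : ∃ y : TyP X, TyP.abs y = x := by
  rcases x with a | ⟨M, σ⟩
  · exact ⟨⟨Sum.inl a, fun e => nomatch e⟩, rfl⟩
  · induction M using Quotient.inductionOn with
    | h l =>
      refine ⟨⟨Sum.inr l.length, fun o => match o with
        | none => σ
        | some i => l.get i⟩, ?_⟩
      show Sum.inr (Finset.univ.val.map (fun i : Fin l.length => l.get i), σ) = Sum.inr (_, σ)
      congr 2
      simp [Fin.univ_val_map]

noncomputable instance : QPF TyF where
  P := TyP
  abs := TyP.abs
  repr x := Classical.choose (TyP.abs_surjective x)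
  abs_repr x := Classical.choose_spec (TyP.abs_surjective x)
  abs_map f p := by
    rcases p with ⟨a | n, g⟩
    · rfl
    · show Sum.inr _ = Sum.inr _
      congr 2
      exact (Multiset.map_map _ _ _).symm

/-- Types: the least fixed point of `TyF`. -/
noncomputable def Ty : Type := QPF.Fix TyF

/-- Base types. -/
noncomputable def Ty.base (a : ℕ) : Ty := QPF.Fix.mk (F := TyF) (Sum.inl a)

/-- The type `M → σ`. -/
noncomputable def Ty.arrow (M : Multiset Ty) (σ : Ty) : Ty := QPF.Fix.mk (F := TyF) (Sum.inr (M, σ))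

theorem Ty.mk_inj {x y : TyF Ty} (h : QPF.Fix.mk (F := TyF) x = QPF.Fix.mk (F := TyF) y) :
    x = y :=
  ((QPF.Fix.dest_mk (F := TyF) x).symm.trans (congrArg (QPF.Fix.dest (F := TyF)) h)).trans
    (QPF.Fix.dest_mk (F := TyF) y)

theorem Ty.arrow_inj {M N : Multiset Ty} {σ τ : Ty} :
    Ty.arrow M σ = Ty.arrow N τ ↔ M = N ∧ σ = τ := by
  constructor
  · intro h
    exact Prod.mk.inj (Sum.inr.inj (Ty.mk_inj h))
  · rintro ⟨rfl, rfl⟩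
    rfl

theorem Ty.base_inj {a b : ℕ} : Ty.base a = Ty.base b ↔ a = b := by
  constructor
  · intro h
    exact Sum.inl.inj (Ty.mk_inj h)
  · rintro rfl
    rfl

theorem Ty.base_ne_arrow (a : ℕ) (M : Multiset Ty) (σ : Ty) : Ty.base a ≠ Ty.arrow M σ := by
  intro h
  exact Sum.inl_ne_inr (Ty.mk_inj h)

theorem Ty.ind {p : Ty → Prop} (hb : ∀ a, p (Ty.base a))
    (ha : ∀ M σ, (∀ τ ∈ M, p τ) → p σ → p (Ty.arrow M σ)) (σ : Ty) : p σ := by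
  refine QPF.Fix.ind (F := TyF) p ?_ σ
  rintro (a | ⟨M, τ⟩) h
  · exact hb a
  · obtain ⟨c, f, hcf, hp⟩ := (QPF.liftp_iff (F := TyF) (α := Ty) p _).1 h
    rcases c with a | n
    · exact absurd hcf Sum.inr_ne_inl
    · have e : (M, τ) = (Finset.univ.val.map (fun i : Fin n => f (some i)), f none) :=
        Sum.inr.inj hcf
      obtain ⟨rfl, rfl⟩ := Prod.mk.inj e
      refine ha _ _ ?_ (hp none)
      intro τ hτ
      obtain ⟨i, -, rfl⟩ := Multiset.mem_map.1 hτ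
      exact hp (some i)

/-! ### The type system -/

/-- Typing environments. `Γ ∧ Δ` is the pointwise sum `Γ + Δ`; variables outside the domain of `Γ`
have the empty multiset. Derivable judgments only have environments with finite domain. -/
abbrev Env : Type := ℕ → Multiset Ty

/-- The environment `Γ; x : M`, where `x` is a new variable with index `0`. -/
def Env.cons (M : Multiset Ty) (Γ : Env) : Env
  | 0 => M
  | n + 1 => Γ n

/-- The multiset `[f i]_{i ∈ I}`. -/
def bag {ι α : Type} [Fintype ι] (f : ι → α) : Multiset α := Finset.univ.val.map f

/-- `Choice M N`: the multiset `N` is an admissible value of `#(M)`, that is, `N = M` if `M` is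
not empty, and `N = [σ]` for an arbitrary type `σ` if `M` is empty. -/
def Choice (M N : Multiset Ty) : Prop := (M ≠ 0 ∧ N = M) ∨ (M = 0 ∧ ∃ σ : Ty, N = {σ})

/-- What a judgment assigns to a term: a type or a multiset of types. -/
inductive Pred : Type
  | ty (σ : Ty)
  | multi (M : Multiset Ty)

/-- `Der Γ t (.ty σ) k` (`Der Γ t (.multi M) k`): the judgment `Γ ⊢ t : σ` (`Γ ⊢ t : M`) has a
derivation in `∩J` of size `k`, the number of its rule instances other than `many`. -/
inductive Der : Env → Term → Pred → ℕ → Prop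
  | var (x : ℕ) (σ : Ty) : Der (Pi.single x {σ}) (var x) (.ty σ) 1
  | lam {Γ : Env} {M : Multiset Ty} {t : Term} {σ : Ty} {k : ℕ} :
      Der (Env.cons M Γ) t (.ty σ) k → Der Γ (lam t) (.ty (Ty.arrow M σ)) (k + 1)
  | many {ι : Type} [Fintype ι] [Nonempty ι] {Γ : ι → Env} {t : Term} {σ : ι → Ty} {k : ι → ℕ} :
      (∀ i, Der (Γ i) t (.ty (σ i)) (k i)) →
      Der (∑ i, Γ i) t (.multi (bag σ)) (∑ i, k i)
  | app {ι : Type} [Fintype ι] {M : ι → Multiset Ty} {τ : ι → Ty} {N P : Multiset Ty}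
      {Γ Δ Λ : Env} {t u r : Term} {σ : Ty} {k₁ k₂ k₃ : ℕ} :
      Choice (bag fun i => Ty.arrow (M i) (τ i)) N →
      Choice (∑ i, M i) P →
      Der Γ t (.multi N) k₁ →
      Der Δ u (.multi P) k₂ →
      Der (Env.cons (bag τ) Λ) r (.ty σ) k₃ →
      Der (Γ + Δ + Λ) (app t u r) (.ty σ) (k₁ + k₂ + k₃ + 1)

/-- `Typing Γ t σ k`: the judgment `Γ ⊢ t : σ` has a derivation of size `k` in `∩J`. -/
def Typing (Γ : Env) (t : Term) (σ : Ty) (k : ℕ) : Prop := Der Γ t (.ty σ) k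

/-- `t` is typable in `∩J`. -/
def Typable (t : Term) : Prop := ∃ (Γ : Env) (σ : Ty) (k : ℕ), Typing Γ t σ k

end GenApp

open GenApp

namespace GenApp

open Term

/-! ### Environments and renamings -/

namespace Env

/-! The exact system is not stable under `π`: in t(u, x.r)(u', y.r') the inner application may be
typed several times, each time with its own derivations of t and u, whereas the reduct types t and u
as often as the single body demands. The surplus derivations then have no place. The affine system
`Aff` gives them one: environments may be weakened, and the function and argument of an application
may carry more types than are used. Every exact derivation is an affine one of the same size.

In `Aff`, subject reduction holds with the same environment and type. A `β`-step lowers the size,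
since substitution at most adds the sizes of the two derivations and the application node disappears
(`Aff.beta_root`). A `π`-step does not raise it, since the copies of the inner application merge
into one (`Aff.app_multi`, `Aff.pi_root`). Function and argument always receive a non-empty
multiset, so each subterm is really typed and a strict decrease survives in every context. The size
thus bounds the number of `β`-steps, and termination follows from the lexicographic order on the
size and a weight that `π`-steps decrease (`Aff.acc`).

Conversely, typability, without control of environment or size, is closed under root expansion: for
`β` by decomposing a derivation of a substitution instance (`Lin.unsubst`), for `π` by distributing
the types of the bound variable among the derivations of the body (`app_multi_expansion`). Induction
along reduction, applied to all subterms at once, then types every strongly normalizing term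
(`typable_of_acc`).

The counterexamples for `π` rest on exactness: an erasing application types its head exactly once,
and no derivation is smaller than its term. -/

@[simp] theorem cons_zero (M : Multiset Ty) (Γ : Env) : cons M Γ 0 = M := rfl

@[simp] theorem cons_succ (M : Multiset Ty) (Γ : Env) (n : ℕ) : cons M Γ (n + 1) = Γ n := rfl

theorem cons_add (M N : Multiset Ty) (Γ Δ : Env) :
    cons (M + N) (Γ + Δ) = cons M Γ + cons N Δ := by
  funext n; cases n <;> rfl

theorem cons_zero_add (M : Multiset Ty) (Γ Δ : Env) :
    cons M Γ + cons 0 Δ = cons M (Γ + Δ) := by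
  rw [← cons_add, add_zero]

@[simp] theorem cons_inj {M N : Multiset Ty} {Γ Δ : Env} :
    cons M Γ = cons N Δ ↔ M = N ∧ Γ = Δ := by
  constructor
  · intro h
    exact ⟨congrFun h 0, funext fun n => congrFun h (n + 1)⟩
  · rintro ⟨rfl, rfl⟩; rfl

theorem cons_tail (Γ : Env) : cons (Γ 0) (fun n => Γ (n + 1)) = Γ := by
  funext n; cases n <;> rfl

theorem cons_le {M : Multiset Ty} {Γ Δ : Env} (h : Γ ≤ Δ) : cons M Γ ≤ cons M Δ := by
  intro n; cases n with
  | zero => exact le_rfl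
  | succ n => exact h n

/-- The image of an environment under a renaming. -/
noncomputable def push (ρ : ℕ → ℕ) (Γ : Env) : Env := Function.extend ρ Γ 0

theorem push_apply {ρ : ℕ → ℕ} (hρ : ρ.Injective) (Γ : Env) (n : ℕ) : push ρ Γ (ρ n) = Γ n :=
  hρ.extend_apply _ _ _

theorem push_eq_zero {ρ : ℕ → ℕ} (Γ : Env) {m : ℕ} (h : ∀ n, ρ n ≠ m) : push ρ Γ m = 0 :=
  Function.extend_apply' _ _ _ (by rintro ⟨n, hn⟩; exact h n hn)

theorem push_add (ρ : ℕ → ℕ) (Γ Δ : Env) : push ρ (Γ + Δ) = push ρ Γ + push ρ Δ := by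
  have h := Function.extend_add ρ Γ Δ (0 : Env) 0
  rwa [add_zero] at h

theorem push_zero (ρ : ℕ → ℕ) : push ρ 0 = 0 := Function.extend_zero ρ

theorem eq_push {ρ : ℕ → ℕ} (hρ : ρ.Injective) {Γ Δ : Env} (h : ∀ n, Δ (ρ n) = Γ n)
    (h0 : ∀ m, (∀ n, ρ n ≠ m) → Δ m = 0) : Δ = push ρ Γ := by
  funext m
  by_cases hm : ∃ n, ρ n = m
  · obtain ⟨n, rfl⟩ := hm
    rw [h, push_apply hρ]
  · push Not at hm
    rw [h0 m hm, push_eq_zero Γ hm]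

theorem upRen_injective {ρ : ℕ → ℕ} (hρ : ρ.Injective) : (upRen ρ).Injective := by
  rintro (_ | a) (_ | b) h
  · rfl
  · cases h
  · cases h
  · rw [hρ (Nat.succ.inj h)]

theorem push_upRen {ρ : ℕ → ℕ} (hρ : ρ.Injective) (M : Multiset Ty) (Γ : Env) :
    push (upRen ρ) (cons M Γ) = cons M (push ρ Γ) := by
  symm
  apply eq_push (upRen_injective hρ)
  · rintro (_ | n)
    · rfl
    · exact push_apply hρ Γ n
  · rintro (_ | m) hm
    · exact absurd rfl (hm 0)
    · exact push_eq_zero Γ fun n hn => hm (n + 1) (by rw [← hn]; rfl)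

theorem push_succ (Γ : Env) : push Nat.succ Γ = cons 0 Γ := by
  symm
  apply eq_push Nat.succ_injective
  · intro n; rfl
  · rintro (_ | m) hm
    · rfl
    · exact absurd rfl (hm m)

theorem push_single {ρ : ℕ → ℕ} (hρ : ρ.Injective) (x : ℕ) (M : Multiset Ty) :
    push ρ (Pi.single x M) = Pi.single (ρ x) M := by
  symm
  apply eq_push hρ
  · intro n
    by_cases h : n = x
    · subst h; simp
    · rw [Pi.single_eq_of_ne h, Pi.single_eq_of_ne (fun e => h (hρ e))]
  · intro m hm
    exact Pi.single_eq_of_ne (fun e => hm x e.symm) _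

end Env

/-- The renaming which skips the variable `c`. -/
def skip : ℕ → ℕ → ℕ
  | 0 => Nat.succ
  | c + 1 => upRen (skip c)

theorem eq_or_skip (c x : ℕ) : x = c ∨ ∃ n, x = skip c n := by
  induction c generalizing x with
  | zero =>
    cases x with
    | zero => exact Or.inl rfl
    | succ n => exact Or.inr ⟨n, rfl⟩
  | succ c ih =>
    cases x with
    | zero => exact Or.inr ⟨0, rfl⟩
    | succ x =>
      rcases ih x with h | ⟨n, h⟩
      · exact Or.inl (congrArg _ h)
      · exact Or.inr ⟨n + 1, congrArg Nat.succ h⟩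

theorem skip_ne (c n : ℕ) : skip c n ≠ c := by
  induction c generalizing n with
  | zero => exact Nat.succ_ne_zero n
  | succ c ih =>
    cases n with
    | zero => exact (Nat.succ_ne_zero c).symm
    | succ n => exact fun h => ih n (Nat.succ.inj h)

theorem skip_injective (c : ℕ) : (skip c).Injective := by
  induction c with
  | zero => exact Nat.succ_injective
  | succ c ih => exact Env.upRen_injective ih

theorem cons_comp_skip (M : Multiset Ty) (Γ : Env) (c : ℕ) :
    Env.cons M Γ ∘ skip (c + 1) = Env.cons M (Γ ∘ skip c) := by
  funext n; cases n <;> rfl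

theorem single_comp_skip (c : ℕ) (M : Multiset Ty) : (Pi.single c M : Env) ∘ skip c = 0 := by
  funext n; exact Pi.single_eq_of_ne (skip_ne c n) _

theorem single_skip_comp_skip (c n : ℕ) (M : Multiset Ty) :
    (Pi.single (skip c n) M : Env) ∘ skip c = Pi.single n M := by
  funext m
  by_cases h : m = n
  · subst h; simp
  · rw [Pi.single_eq_of_ne h]
    exact Pi.single_eq_of_ne (fun e => h (skip_injective c e)) _

/-- `θ` substitutes `u` for the variable `c` and removes this variable. -/
def Single (c : ℕ) (u : Term) (θ : ℕ → Term) : Prop :=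
  θ c = u ∧ ∀ n, θ (skip c n) = var n

theorem Single.up {c : ℕ} {u : Term} {θ : ℕ → Term} (h : Single c u θ) :
    Single (c + 1) (rename Nat.succ u) (upSub θ) := by
  refine ⟨congrArg (rename Nat.succ) h.1, ?_⟩
  rintro (_ | n)
  · rfl
  · exact congrArg (rename Nat.succ) (h.2 n)

/-! ### The exact system with multisets built entry by entry -/

/-- The multiset `[Mᵢ → τᵢ]`. -/
noncomputable def arrows (A : Multiset (Multiset Ty × Ty)) : Multiset Ty :=
  A.map fun p => Ty.arrow p.1 p.2

/-- The multiset `⊔ Mᵢ`. -/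
def domains (A : Multiset (Multiset Ty × Ty)) : Multiset Ty := (A.map Prod.fst).sum

/-- The multiset `[τᵢ]`. -/
def codomains (A : Multiset (Multiset Ty × Ty)) : Multiset Ty := A.map Prod.snd

@[simp] theorem arrows_zero : arrows 0 = 0 := rfl
@[simp] theorem domains_zero : domains 0 = 0 := rfl
@[simp] theorem codomains_zero : codomains 0 = 0 := rfl
@[simp] theorem arrows_cons (p : Multiset Ty × Ty) (A : Multiset (Multiset Ty × Ty)) :
    arrows (p ::ₘ A) = Ty.arrow p.1 p.2 ::ₘ arrows A := Multiset.map_cons _ _ _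
@[simp] theorem domains_cons (p : Multiset Ty × Ty) (A : Multiset (Multiset Ty × Ty)) :
    domains (p ::ₘ A) = p.1 + domains A := by simp [domains]
@[simp] theorem codomains_cons (p : Multiset Ty × Ty) (A : Multiset (Multiset Ty × Ty)) :
    codomains (p ::ₘ A) = p.2 ::ₘ codomains A := Multiset.map_cons _ _ _
@[simp] theorem arrows_add (A B : Multiset (Multiset Ty × Ty)) :
    arrows (A + B) = arrows A + arrows B := Multiset.map_add _ _ _
@[simp] theorem domains_add (A B : Multiset (Multiset Ty × Ty)) :
    domains (A + B) = domains A + domains B := by simp [domains]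
@[simp] theorem codomains_add (A B : Multiset (Multiset Ty × Ty)) :
    codomains (A + B) = codomains A + codomains B := Multiset.map_add _ _ _

/-- Lifts a splitting of the types of a bound variable to the arrows that provide them, so that the
arrows can be shared out among several derivations of a body. -/
theorem codomains_eq_add {A : Multiset (Multiset Ty × Ty)} {B C : Multiset Ty}
    (h : codomains A = B + C) :
    ∃ A₁ A₂, A = A₁ + A₂ ∧ codomains A₁ = B ∧ codomains A₂ = C := by
  classical
  induction B using Multiset.induction generalizing A with
  | empty => exact ⟨0, A, (zero_add A).symm, rfl, by rw [h, zero_add]⟩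
  | cons b B ih =>
    rw [Multiset.cons_add] at h
    obtain ⟨a, ha, rfl, h'⟩ := (Multiset.map_eq_cons _ _ _ _).2 h
    obtain ⟨A₁, A₂, e, rfl, rfl⟩ := ih h'
    refine ⟨a ::ₘ A₁, A₂, ?_, by simp, rfl⟩
    rw [Multiset.cons_add, ← e, Multiset.cons_erase ha]

theorem Choice.ne_zero {M N : Multiset Ty} (h : Choice M N) : N ≠ 0 := by
  rcases h with ⟨h, rfl⟩ | ⟨-, σ, rfl⟩
  · exact h
  · exact Multiset.singleton_ne_zero σ

theorem Choice.le {M N : Multiset Ty} (h : Choice M N) : M ≤ N := by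
  rcases h with ⟨-, rfl⟩ | ⟨rfl, -⟩
  · exact le_rfl
  · exact Multiset.zero_le _

/-- Derivability in `∩J`, where the premises of `many` are added one by one, starting from none. -/
inductive Lin : Env → Term → Pred → ℕ → Prop
  | var (x : ℕ) (σ : Ty) : Lin (Pi.single x {σ}) (var x) (.ty σ) 1
  | lam {Γ : Env} {M : Multiset Ty} {t : Term} {σ : Ty} {k : ℕ} :
      Lin (Env.cons M Γ) t (.ty σ) k → Lin Γ (lam t) (.ty (Ty.arrow M σ)) (k + 1)
  | nil (t : Term) : Lin 0 t (.multi 0) 0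
  | cons {Γ Δ : Env} {t : Term} {σ : Ty} {M : Multiset Ty} {k m : ℕ} :
      Lin Γ t (.ty σ) k → Lin Δ t (.multi M) m → Lin (Γ + Δ) t (.multi (σ ::ₘ M)) (k + m)
  | app {A : Multiset (Multiset Ty × Ty)} {N P : Multiset Ty}
      {Γ Δ Λ : Env} {t u r : Term} {σ : Ty} {k₁ k₂ k₃ : ℕ} :
      Choice (arrows A) N →
      Choice (domains A) P →
      Lin Γ t (.multi N) k₁ →
      Lin Δ u (.multi P) k₂ →
      Lin (Env.cons (codomains A) Λ) r (.ty σ) k₃ →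
      Lin (Γ + Δ + Λ) (app t u r) (.ty σ) (k₁ + k₂ + k₃ + 1)

theorem bag_option {ι α : Type} [Fintype ι] (f : Option ι → α) :
    bag f = f none ::ₘ bag fun i => f (some i) := by
  rw [bag, show (Finset.univ : Finset (Option ι)) = Finset.insertNone Finset.univ from rfl]
  simp [bag, Finset.insertNone]

theorem exists_bag {α : Type} (A : Multiset α) : ∃ (n : ℕ) (f : Fin n → α), A = bag f := by
  induction A using Quotient.inductionOn with
  | h l => exact ⟨l.length, l.get, by simp [bag, Fin.univ_val_map]⟩

theorem Lin.of_der {Γ : Env} {t : Term} {p : Pred} {k : ℕ} (h : Der Γ t p k) : Lin Γ t p k := by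
  induction h with
  | var x σ => exact Lin.var x σ
  | lam _ ih => exact Lin.lam ih
  | @many ι _ _ Γ t σ k _ ih =>
    classical
    -- Subfamilies, including the empty one, make the premises available one at a time.
    suffices H : ∀ s : Finset ι,
        Lin (∑ i ∈ s, Γ i) t (.multi (s.val.map σ)) (∑ i ∈ s, k i) from H Finset.univ
    intro s
    induction s using Finset.induction_on with
    | empty => exact Lin.nil t
    | insert a s ha hs =>
      rw [Finset.sum_insert ha, Finset.sum_insert ha, Finset.insert_val_of_notMem ha,
        Multiset.map_cons]
      exact Lin.cons (ih a) hs
  | @app ι _ M τ N P Γ Δ Λ t u r σ k₁ k₂ k₃ hN hP _ _ _ ih₁ ih₂ ih₃ =>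
    refine Lin.app (A := bag fun i => (M i, τ i)) ?_ ?_ ih₁ ih₂ ?_
    · simpa [arrows, bag, Multiset.map_map, Function.comp_def] using hN
    · simpa [domains, bag, Multiset.map_map, Function.comp_def] using hP
    · simpa [codomains, bag, Multiset.map_map, Function.comp_def] using ih₃

/-- The shape in which a judgment of `Lin` becomes a judgment of `Der`. -/
def DerShape (Γ : Env) (t : Term) (k : ℕ) : Pred → Prop
  | .ty σ => Der Γ t (.ty σ) k
  | .multi M => ∃ (ι : Type) (_ : Fintype ι) (Δ : ι → Env) (σ : ι → Ty) (m : ι → ℕ),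
      (∀ i, Der (Δ i) t (.ty (σ i)) (m i)) ∧ Γ = ∑ i, Δ i ∧ M = bag σ ∧ k = ∑ i, m i

theorem DerShape.der {Γ : Env} {t : Term} {k : ℕ} {M : Multiset Ty}
    (h : DerShape Γ t k (.multi M)) (hM : M ≠ 0) : Der Γ t (.multi M) k := by
  obtain ⟨ι, _, Δ, σ, m, hd, rfl, rfl, rfl⟩ := h
  have : Nonempty ι := by
    by_contra hι
    rw [not_nonempty_iff] at hι
    exact hM (by simp [bag])
  exact Der.many hd

/-- `Lin.nil` has no counterpart in `Der`, so a multiset judgment is unfolded into a possibly empty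
family of derivations. It is closed by `many` only at an application, where `Choice` guarantees that
the family is non-empty. -/
theorem Lin.derShape {Γ : Env} {t : Term} {p : Pred} {k : ℕ} (h : Lin Γ t p k) :
    DerShape Γ t k p := by
  induction h with
  | var x σ => exact Der.var x σ
  | lam _ ih => exact Der.lam ih
  | nil t =>
    exact ⟨Empty, inferInstance, fun _ => 0, Empty.elim, fun _ => 0, fun i => i.elim,
      by simp, by simp [bag], by simp⟩
  | @cons Γ' _ _ σ' _ k' _ _ _ ih₁ ih₂ =>
    obtain ⟨ι, _, Δ, σ, m, hd, rfl, rfl, rfl⟩ := ih₂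
    refine ⟨Option ι, inferInstance, fun o => o.elim Γ' Δ, fun o => o.elim σ' σ,
      fun o => o.elim k' m, ?_, ?_, ?_, ?_⟩
    · rintro (_ | i)
      · exact ih₁
      · exact hd i
    · rw [Fintype.sum_option]; rfl
    · rw [bag_option]; rfl
    · rw [Fintype.sum_option]; rfl
  | @app A N P Γ Δ Λ t u r σ k₁ k₂ k₃ hN hP _ _ _ ih₁ ih₂ ih₃ =>
    obtain ⟨n, f, rfl⟩ := exists_bag A
    refine Der.app (M := fun i => (f i).1) (τ := fun i => (f i).2) ?_ ?_
      (DerShape.der ih₁ hN.ne_zero) (DerShape.der ih₂ hP.ne_zero) ?_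
    · simpa [arrows, bag, Multiset.map_map, Function.comp_def] using hN
    · simpa [domains, bag, Multiset.map_map, Function.comp_def, Finset.sum] using hP
    · simpa [DerShape, codomains, bag, Multiset.map_map, Function.comp_def] using ih₃

theorem typing_iff {Γ : Env} {t : Term} {σ : Ty} {k : ℕ} :
    Typing Γ t σ k ↔ Lin Γ t (.ty σ) k :=
  ⟨Lin.of_der, Lin.derShape⟩


/-! ### The affine system -/

/-- The affine variant of `∩J`: environments may be weakened, and the premises of an application
may provide more types than needed. -/
inductive Aff : Env → Term → Pred → ℕ → Prop
  | var {Γ : Env} {x : ℕ} {σ : Ty} : σ ∈ Γ x → Aff Γ (var x) (.ty σ) 1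
  | lam {Γ : Env} {M : Multiset Ty} {t : Term} {σ : Ty} {k : ℕ} :
      Aff (Env.cons M Γ) t (.ty σ) k → Aff Γ (lam t) (.ty (Ty.arrow M σ)) (k + 1)
  | nil (Γ : Env) (t : Term) : Aff Γ t (.multi 0) 0
  | cons {Γ Δ : Env} {t : Term} {σ : Ty} {M : Multiset Ty} {k m : ℕ} :
      Aff Γ t (.ty σ) k → Aff Δ t (.multi M) m → Aff (Γ + Δ) t (.multi (σ ::ₘ M)) (k + m)
  | app {A : Multiset (Multiset Ty × Ty)} {N P : Multiset Ty}
      {Γ Δ Λ : Env} {t u r : Term} {σ : Ty} {k₁ k₂ k₃ : ℕ} :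
      N ≠ 0 → P ≠ 0 → arrows A ≤ N → domains A ≤ P →
      Aff Γ t (.multi N) k₁ →
      Aff Δ u (.multi P) k₂ →
      Aff (Env.cons (codomains A) Λ) r (.ty σ) k₃ →
      Aff (Γ + Δ + Λ) (app t u r) (.ty σ) (k₁ + k₂ + k₃ + 1)

theorem Lin.aff {Γ : Env} {t : Term} {p : Pred} {k : ℕ} (h : Lin Γ t p k) : Aff Γ t p k := by
  induction h with
  | var x σ => exact Aff.var (by simp)
  | lam _ ih => exact Aff.lam ih
  | nil t => exact Aff.nil _ t
  | cons _ _ ih₁ ih₂ => exact Aff.cons ih₁ ih₂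
  | app hN hP _ _ _ ih₁ ih₂ ih₃ =>
    exact Aff.app hN.ne_zero hP.ne_zero hN.le hP.le ih₁ ih₂ ih₃

namespace Aff

theorem weaken {Γ Γ' : Env} {t : Term} {p : Pred} {k : ℕ} (h : Aff Γ t p k) (hΓ : Γ ≤ Γ') :
    Aff Γ' t p k := by
  induction h generalizing Γ' with
  | var h => exact Aff.var (Multiset.mem_of_le (hΓ _) h)
  | lam _ ih => exact Aff.lam (ih (Env.cons_le hΓ))
  | nil _ t => exact Aff.nil _ t
  | cons h₁ _ _ ih₂ =>
    obtain ⟨E, rfl⟩ := le_iff_exists_add.1 hΓ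
    rw [add_assoc]
    exact Aff.cons h₁ (ih₂ le_self_add)
  | app hN hP hA hD h₁ h₂ _ _ _ ih₃ =>
    obtain ⟨E, rfl⟩ := le_iff_exists_add.1 hΓ
    rw [add_assoc]
    exact Aff.app hN hP hA hD h₁ h₂ (ih₃ (Env.cons_le le_self_add))

theorem rename {Γ : Env} {t : Term} {p : Pred} {k : ℕ} (h : Aff Γ t p k) {ρ : ℕ → ℕ}
    (hρ : ρ.Injective) : Aff (Env.push ρ Γ) (rename ρ t) p k := by
  induction h generalizing ρ with
  | var h => exact Aff.var (by rwa [Env.push_apply hρ])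
  | lam _ ih =>
    refine Aff.lam ?_
    rw [← Env.push_upRen hρ]
    exact ih (Env.upRen_injective hρ)
  | nil _ t => exact Aff.nil _ _
  | cons _ _ ih₁ ih₂ =>
    rw [Env.push_add]
    exact Aff.cons (ih₁ hρ) (ih₂ hρ)
  | app hN hP hA hD _ _ _ ih₁ ih₂ ih₃ =>
    rw [Env.push_add, Env.push_add]
    refine Aff.app hN hP hA hD (ih₁ hρ) (ih₂ hρ) ?_
    rw [← Env.push_upRen hρ]
    exact ih₃ (Env.upRen_injective hρ)

theorem rename_succ {Γ : Env} {t : Term} {p : Pred} {k : ℕ} (h : Aff Γ t p k) :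
    Aff (Env.cons 0 Γ) (Term.rename Nat.succ t) p k := by
  rw [← Env.push_succ]
  exact h.rename Nat.succ_injective

/-- Multisets are unordered, so the required entry may lie below the one added last; the two are
then exchanged, which changes neither the total environment nor the total size. -/
theorem cons_inv {Γ : Env} {t : Term} {σ : Ty} {M : Multiset Ty} {k : ℕ}
    (h : Aff Γ t (.multi (σ ::ₘ M)) k) :
    ∃ Γ₁ Γ₂ k₁ k₂, Γ = Γ₁ + Γ₂ ∧ k = k₁ + k₂ ∧ Aff Γ₁ t (.ty σ) k₁ ∧ Aff Γ₂ t (.multi M) k₂ := by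
  generalize hp : Pred.multi (σ ::ₘ M) = p at h
  induction h generalizing M with
  | var | lam | app => cases hp
  | nil => exact absurd (Pred.multi.inj hp) (Multiset.cons_ne_zero)
  | @cons Γ Δ t τ M' k m h₁ h₂ _ ih =>
    rcases Multiset.cons_eq_cons.1 (Pred.multi.inj hp) with ⟨rfl, rfl⟩ | ⟨-, C, rfl, rfl⟩
    · exact ⟨Γ, Δ, k, m, rfl, rfl, h₁, h₂⟩
    · obtain ⟨Γ₁, Γ₂, k₁, k₂, rfl, rfl, h₃, h₄⟩ := ih rfl
      exact ⟨Γ₁, Γ + Γ₂, k₁, k + k₂, by abel, by abel, h₃, Aff.cons h₁ h₄⟩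

theorem split {Γ : Env} {t : Term} {M N : Multiset Ty} {k : ℕ}
    (h : Aff Γ t (.multi (M + N)) k) :
    ∃ Γ₁ Γ₂ k₁ k₂, Γ = Γ₁ + Γ₂ ∧ k = k₁ + k₂ ∧
      Aff Γ₁ t (.multi M) k₁ ∧ Aff Γ₂ t (.multi N) k₂ := by
  induction M using Multiset.induction generalizing Γ k with
  | empty => exact ⟨0, Γ, 0, k, by simp, by simp, Aff.nil _ t, by simpa using h⟩
  | cons σ M ih =>
    rw [Multiset.cons_add] at h
    obtain ⟨Γ₁, Γ₂, k₁, k₂, rfl, rfl, h₁, h₂⟩ := h.cons_inv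
    obtain ⟨Γ₃, Γ₄, k₃, k₄, rfl, rfl, h₃, h₄⟩ := ih h₂
    exact ⟨Γ₁ + Γ₃, Γ₄, k₁ + k₃, k₄, by abel, by abel, Aff.cons h₁ h₃, h₄⟩

theorem multi_mono {Γ : Env} {t : Term} {M N : Multiset Ty} {k : ℕ}
    (h : Aff Γ t (.multi N) k) (hMN : M ≤ N) : ∃ k' ≤ k, Aff Γ t (.multi M) k' := by
  obtain ⟨C, rfl⟩ := Multiset.le_iff_exists_add.1 hMN
  obtain ⟨Γ₁, Γ₂, k₁, k₂, rfl, rfl, h₁, -⟩ := h.split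
  exact ⟨k₁, by omega, h₁.weaken le_self_add⟩

theorem size_nil {Γ : Env} {t : Term} {k : ℕ} (h : Aff Γ t (.multi 0) k) : k = 0 := by
  generalize hp : Pred.multi 0 = p at h
  cases h with
  | nil => rfl
  | cons => exact absurd (Pred.multi.inj hp).symm Multiset.cons_ne_zero
  | _ => cases hp

theorem add {Γ Δ : Env} {t : Term} {M N : Multiset Ty} {k m : ℕ}
    (h : Aff Γ t (.multi M) k) (h' : Aff Δ t (.multi N) m) :
    Aff (Γ + Δ) t (.multi (M + N)) (k + m) := by
  induction M using Multiset.induction generalizing Γ k with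
  | empty =>
    obtain rfl := h.size_nil
    simpa using h'.weaken le_add_self
  | cons σ M ih =>
    obtain ⟨Γ₁, Γ₂, k₁, k₂, rfl, rfl, h₁, h₂⟩ := h.cons_inv
    rw [Multiset.cons_add, add_assoc, add_assoc]
    exact Aff.cons h₁ (ih h₂)

/-- The derivations of `u` are split among the premises along the splitting of `Γ c`. Each is used
at most once, so the sizes at most add up. -/
theorem subst {Γ : Env} {t : Term} {p : Pred} {k : ℕ} (h : Aff Γ t p k) {c : ℕ} {u : Term}
    {θ : ℕ → Term} (hθ : Single c u θ) {Δ : Env} {m : ℕ} (hu : Aff Δ u (.multi (Γ c)) m) :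
    ∃ k' ≤ k + m, Aff (Γ ∘ skip c + Δ) (subst θ t) p k' := by
  induction h generalizing c u θ Δ m with
  | @var Γ x σ h =>
    rcases eq_or_skip c x with rfl | ⟨n, rfl⟩
    · obtain ⟨M, hM⟩ := Multiset.exists_cons_of_mem h
      rw [hM] at hu
      obtain ⟨Δ₁, Δ₂, k₁, k₂, rfl, rfl, h₁, -⟩ := hu.cons_inv
      refine ⟨k₁, by omega, ?_⟩
      simp only [Term.subst, hθ.1]
      -- The derivations of `u` for the other types of `c` are discarded, and their environment is
      -- absorbed by weakening.
      refine h₁.weaken ?_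
      rw [add_left_comm]
      exact le_self_add
    · refine ⟨1, by omega, ?_⟩
      simp only [Term.subst, hθ.2]
      exact Aff.var (Multiset.mem_add.2 (Or.inl h))
  | lam _ ih =>
    obtain ⟨k', hk, h'⟩ := ih hθ.up hu.rename_succ
    refine ⟨k' + 1, by omega, Aff.lam ?_⟩
    rwa [cons_comp_skip, Env.cons_zero_add] at h'
  | nil => exact ⟨0, by omega, Aff.nil _ _⟩
  | cons _ _ ih₁ ih₂ =>
    obtain ⟨Δ₁, Δ₂, m₁, m₂, rfl, rfl, hu₁, hu₂⟩ := hu.split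
    obtain ⟨k₁, hk₁, h₁⟩ := ih₁ hθ hu₁
    obtain ⟨k₂, hk₂, h₂⟩ := ih₂ hθ hu₂
    refine ⟨k₁ + k₂, by omega, ?_⟩
    have := Aff.cons h₁ h₂
    rwa [add_add_add_comm] at this
  | app hN hP hA hD _ _ _ ih₁ ih₂ ih₃ =>
    obtain ⟨Δ₁₂, Δ₃, m₁₂, m₃, rfl, rfl, hu₁₂, hu₃⟩ := hu.split
    obtain ⟨Δ₁, Δ₂, m₁, m₂, rfl, rfl, hu₁, hu₂⟩ := hu₁₂.split
    obtain ⟨k₁, hk₁, h₁⟩ := ih₁ hθ hu₁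
    obtain ⟨k₂, hk₂, h₂⟩ := ih₂ hθ hu₂
    obtain ⟨k₃, hk₃, h₃⟩ := ih₃ hθ.up hu₃.rename_succ
    rw [cons_comp_skip, Env.cons_zero_add] at h₃
    refine ⟨k₁ + k₂ + k₃ + 1, by omega, ?_⟩
    refine (Aff.app hN hP hA hD h₁ h₂ h₃).weaken (le_of_eq ?_)
    rw [add_add_add_comm (_ ∘ _), add_add_add_comm (_ + _)]
    rfl

theorem inst {M : Multiset Ty} {Γ Δ : Env} {t u : Term} {p : Pred} {k m : ℕ}
    (h : Aff (Env.cons M Γ) t p k) (hu : Aff Δ u (.multi M) m) :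
    ∃ k' ≤ k + m, Aff (Γ + Δ) (inst u t) p k' :=
  h.subst (c := 0) ⟨rfl, fun _ => rfl⟩ hu

theorem lam_inv {Γ : Env} {t : Term} {M : Multiset Ty} {τ : Ty} {k : ℕ}
    (h : Aff Γ (Term.lam t) (.ty (Ty.arrow M τ)) k) :
    ∃ k', k = k' + 1 ∧ Aff (Env.cons M Γ) t (.ty τ) k' := by
  generalize hp : Pred.ty (Ty.arrow M τ) = p at h
  generalize hs : Term.lam t = s at h
  cases h with
  | lam h =>
    cases hs
    obtain ⟨rfl, rfl⟩ := Ty.arrow_inj.1 (Pred.ty.inj hp)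
    exact ⟨_, rfl, h⟩
  | var | app => cases hs
  | nil | cons => cases hp

theorem inst_multi {A : Multiset (Multiset Ty × Ty)} {Γ Δ : Env} {t u : Term} {k m : ℕ}
    (h : Aff Γ (Term.lam t) (.multi (arrows A)) k) (hu : Aff Δ u (.multi (domains A)) m) :
    ∃ k' ≤ k + m, Aff (Γ + Δ) (Term.inst u t) (.multi (codomains A)) k' := by
  induction A using Multiset.induction generalizing Γ Δ k m with
  | empty => exact ⟨0, by omega, Aff.nil _ _⟩
  | cons p A ih =>
    rw [arrows_cons] at h
    rw [domains_cons] at hu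
    obtain ⟨Γ₁, Γ₂, k₁, k₂, rfl, rfl, h₁, h₂⟩ := h.cons_inv
    obtain ⟨Δ₁, Δ₂, m₁, m₂, rfl, rfl, hu₁, hu₂⟩ := hu.split
    obtain ⟨k₁, rfl, ht⟩ := h₁.lam_inv
    obtain ⟨n₁, hn₁, h₃⟩ := ht.inst hu₁
    obtain ⟨n₂, hn₂, h₄⟩ := ih h₂ hu₂
    refine ⟨n₁ + n₂, by omega, ?_⟩
    rw [add_add_add_comm, codomains_cons]
    exact Aff.cons h₃ h₄

/-! ### Subject reduction in the affine system -/

theorem beta_root {t t' : Term} (hb : BetaRoot t t') {Γ : Env} {σ : Ty} {k : ℕ}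
    (h : Aff Γ t (.ty σ) k) : ∃ k', k' + 1 ≤ k ∧ Aff Γ t' (.ty σ) k' := by
  cases hb with
  | mk t u r =>
    cases h with
    | app hN hP hA hD h₁ h₂ h₃ =>
      -- Surplus types, such as the witnesses chosen for an empty multiset, are dropped. The node of
      -- the application gives the strict decrease.
      obtain ⟨k₁, hk₁, h₁⟩ := h₁.multi_mono hA
      obtain ⟨k₂, hk₂, h₂⟩ := h₂.multi_mono hD
      obtain ⟨k₄, hk₄, h₄⟩ := inst_multi h₁ h₂
      obtain ⟨k₅, hk₅, h₅⟩ := h₃.inst h₄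
      exact ⟨k₅, by omega, by rwa [add_comm] at h₅⟩

/-- The derivations of an application are merged into a single one, up to the body. -/
theorem app_multi {N : Multiset Ty} {Γ : Env} {t u r : Term} {k : ℕ}
    (h : Aff Γ (Term.app t u r) (.multi N) k) (hN : N ≠ 0) :
    ∃ A N' P' Γ' Δ' Λ' k₁ k₂ k₃, N' ≠ 0 ∧ P' ≠ 0 ∧ arrows A ≤ N' ∧ domains A ≤ P' ∧
      Aff Γ' t (.multi N') k₁ ∧ Aff Δ' u (.multi P') k₂ ∧
      Aff (Env.cons (codomains A) Λ') r (.multi N) k₃ ∧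
      Γ = Γ' + Δ' + Λ' ∧ k₁ + k₂ + k₃ + 1 ≤ k := by
  induction N using Multiset.induction generalizing Γ k with
  | empty => exact absurd rfl hN
  | cons σ N ih =>
    obtain ⟨Γ₁, Γ₂, k₁, k₂, rfl, rfl, h₁, h₂⟩ := h.cons_inv
    cases h₁ with
    | @app A₁ N₁ P₁ Γ₁ Δ₁ Λ₁ _ _ _ _ a₁ a₂ a₃ hN₁ hP₁ hA₁ hD₁ ht₁ hu₁ hr₁ =>
      rcases eq_or_ne N 0 with rfl | hN₂
      -- For a single derivation, the environment left to the empty rest is moved into that of the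
      -- body.
      · refine ⟨A₁, N₁, P₁, Γ₁, Δ₁, Λ₁ + Γ₂, a₁, a₂, a₃ + 0, hN₁, hP₁, hA₁, hD₁, ht₁, hu₁, ?_,
          by abel, by omega⟩
        rw [← Env.cons_zero_add]
        exact Aff.cons hr₁ (Aff.nil _ _)
      · obtain ⟨A₂, N₂, P₂, Γ₂, Δ₂, Λ₂, b₁, b₂, b₃, -, -, hA₂, hD₂, ht₂, hu₂, hr₂, rfl, hb⟩ :=
          ih h₂ hN₂
        refine ⟨A₁ + A₂, N₁ + N₂, P₁ + P₂, Γ₁ + Γ₂, Δ₁ + Δ₂, Λ₁ + Λ₂, a₁ + b₁, a₂ + b₂, a₃ + b₃,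
          ?_, ?_, ?_, ?_, ht₁.add ht₂, hu₁.add hu₂, ?_, by abel, by omega⟩
        · simp [hN₁]
        · simp [hP₁]
        · rw [arrows_add]; exact add_le_add hA₁ hA₂
        · rw [domains_add]; exact add_le_add hD₁ hD₂
        · rw [codomains_add, Env.cons_add]
          exact Aff.cons hr₁ hr₂

/-- After merging, one application of `t` to `u` has a body typed with all the types `N` that the
outer application needs, so the outer application can be rebuilt inside it. The summand 0 matches
the form of `Decreases`. -/
theorem pi_root {t t' : Term} (hb : PiRoot t t') {Γ : Env} {σ : Ty} {k : ℕ}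
    (h : Aff Γ t (.ty σ) k) : ∃ k', k' + 0 ≤ k ∧ Aff Γ t' (.ty σ) k' := by
  cases hb with
  | mk t u r u' r' =>
    cases h with
    | @app A N P Γ Δ Λ _ _ _ _ a₁ a₂ a₃ hN hP hA hD h₁ h₂ h₃ =>
      obtain ⟨A', N', P', Γ', Δ', Λ', k₁, k₂, k₃, hN', hP', hA', hD', ht, hu, hr, rfl, hk⟩ :=
        app_multi h₁ hN
      have h₃' := h₃.rename (Env.upRen_injective Nat.succ_injective)
      rw [Env.push_upRen Nat.succ_injective, Env.push_succ] at h₃'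
      have hb := Aff.app hN hP hA hD hr h₂.rename_succ h₃'
      rw [Env.cons_zero_add, Env.cons_zero_add] at hb
      refine ⟨k₁ + k₂ + (k₃ + a₂ + a₃ + 1) + 1, by omega, ?_⟩
      have := Aff.app hN' hP' hA' hD' ht hu hb
      rwa [← add_assoc, ← add_assoc] at this

/-- A relation on terms preserves types and decreases sizes by at least `d`. -/
def Decreases (d : ℕ) (R : Term → Term → Prop) : Prop :=
  ∀ {t t' : Term}, R t t' → ∀ {Γ : Env} {σ : Ty} {k : ℕ},
    Aff Γ t (.ty σ) k → ∃ k', k' + d ≤ k ∧ Aff Γ t' (.ty σ) k'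

theorem multi_le {d : ℕ} {t t' : Term}
    (H : ∀ {Γ : Env} {σ : Ty} {k : ℕ},
      Aff Γ t (.ty σ) k → ∃ k', k' + d ≤ k ∧ Aff Γ t' (.ty σ) k')
    {Γ : Env} {M : Multiset Ty} {k : ℕ} (h : Aff Γ t (.multi M) k) :
    ∃ k' ≤ k, Aff Γ t' (.multi M) k' := by
  induction M using Multiset.induction generalizing Γ k with
  | empty => exact ⟨0, by omega, Aff.nil _ _⟩
  | cons σ M ih =>
    obtain ⟨Γ₁, Γ₂, k₁, k₂, rfl, rfl, h₁, h₂⟩ := h.cons_inv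
    obtain ⟨n₁, hn₁, h₁⟩ := H h₁
    obtain ⟨n₂, hn₂, h₂⟩ := ih h₂
    exact ⟨n₁ + n₂, by omega, Aff.cons h₁ h₂⟩

/-- At least one derivation of the term is present, and its loss of `d` is enough. For the empty
multiset nothing would decrease. -/
theorem multi_decreases {d : ℕ} {t t' : Term}
    (H : ∀ {Γ : Env} {σ : Ty} {k : ℕ},
      Aff Γ t (.ty σ) k → ∃ k', k' + d ≤ k ∧ Aff Γ t' (.ty σ) k')
    {Γ : Env} {M : Multiset Ty} {k : ℕ} (h : Aff Γ t (.multi M) k) (hM : M ≠ 0) :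
    ∃ k', k' + d ≤ k ∧ Aff Γ t' (.multi M) k' := by
  obtain ⟨σ, hσ⟩ := Multiset.exists_mem_of_ne_zero hM
  obtain ⟨M, rfl⟩ := Multiset.exists_cons_of_mem hσ
  obtain ⟨Γ₁, Γ₂, k₁, k₂, rfl, rfl, h₁, h₂⟩ := h.cons_inv
  obtain ⟨n₁, hn₁, h₁⟩ := H h₁
  obtain ⟨n₂, hn₂, h₂⟩ := multi_le H h₂
  exact ⟨n₁ + n₂, by omega, Aff.cons h₁ h₂⟩

theorem Decreases.compat {d : ℕ} {R : Term → Term → Prop} (hR : Decreases d R) :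
    Decreases d (Compat R) := by
  intro t t' hs
  induction hs with
  | root h => exact hR h
  | lam _ ih =>
    intro Γ σ k h
    cases h with
    | lam h =>
      obtain ⟨k', hk, h⟩ := ih h
      exact ⟨k' + 1, by omega, Aff.lam h⟩
  | appFun u r _ ih =>
    intro Γ σ k h
    cases h with
    | app hN hP hA hD h₁ h₂ h₃ =>
      obtain ⟨k', hk, h₁⟩ := multi_decreases ih h₁ hN
      exact ⟨_, by omega, Aff.app hN hP hA hD h₁ h₂ h₃⟩
  | appArg t r _ ih =>
    intro Γ σ k h
    cases h with
    | app hN hP hA hD h₁ h₂ h₃ =>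
      obtain ⟨k', hk, h₂⟩ := multi_decreases ih h₂ hP
      exact ⟨_, by omega, Aff.app hN hP hA hD h₁ h₂ h₃⟩
  | appBody t u _ ih =>
    intro Γ σ k h
    cases h with
    | app hN hP hA hD h₁ h₂ h₃ =>
      obtain ⟨k', hk, h₃⟩ := ih h₃
      exact ⟨_, by omega, Aff.app hN hP hA hD h₁ h₂ h₃⟩

theorem betaStep : Decreases 1 BetaStep := Decreases.compat beta_root

theorem piStep : Decreases 0 PiStep := Decreases.compat pi_root

theorem redSeq_le {t t' : Term} {n : ℕ} (hs : RedSeq t n t') {Γ : Env} {σ : Ty} {k : ℕ}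
    (h : Aff Γ t (.ty σ) k) : n ≤ k := by
  induction hs generalizing k with
  | nil => exact Nat.zero_le k
  | beta hb _ ih =>
    obtain ⟨k', hk, h⟩ := betaStep hb h
    have := ih h
    omega
  | pi hb _ ih =>
    obtain ⟨k', hk, h⟩ := piStep hb h
    have := ih h
    omega

end Aff

/-! ### Strong normalization -/

/-- A measure which `π`-steps decrease. -/
def piWeight : Term → ℕ
  | var _ => 1
  | lam t => piWeight t
  | app t u r => piWeight t * (piWeight u + piWeight r + 1)

theorem piWeight_pos (t : Term) : 0 < piWeight t := by
  induction t with
  | var n => exact Nat.one_pos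
  | lam t ih => exact ih
  | app t u r iht _ _ => exact Nat.mul_pos iht (Nat.succ_pos _)

theorem piWeight_rename (ρ : ℕ → ℕ) (t : Term) : piWeight (rename ρ t) = piWeight t := by
  induction t generalizing ρ with
  | var n => rfl
  | lam t ih => exact ih _
  | app t u r iht ihu ihr => simp only [rename, piWeight, iht, ihu, ihr]

theorem PiStep.piWeight_lt {t t' : Term} (h : PiStep t t') : piWeight t' < piWeight t := by
  induction h with
  | root h =>
    cases h with
    | mk t u r u' r' =>
      simp only [piWeight, piWeight_rename]
      rw [mul_assoc]
      refine Nat.mul_lt_mul_of_pos_left ?_ (piWeight_pos t)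
      -- Writing U, U', R' for the weights of `u`, `u'`, `r'`, the two sides differ by (U + 1)(U' +
      -- R').
      nlinarith [piWeight_pos u, piWeight_pos r, piWeight_pos u', piWeight_pos r',
        Nat.zero_le (piWeight u * (piWeight u' + piWeight r'))]
  | lam _ ih => exact ih
  | appFun u r _ ih => exact Nat.mul_lt_mul_of_pos_right ih (Nat.succ_pos _)
  | appArg t r _ ih =>
    exact Nat.mul_lt_mul_of_pos_left (by omega) (piWeight_pos t)
  | appBody t u _ ih =>
    exact Nat.mul_lt_mul_of_pos_left (by omega) (piWeight_pos t)

/-- One `β`- or `π`-step. -/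
def Step (t t' : Term) : Prop := BetaStep t t' ∨ PiStep t t'

theorem sn_iff_acc {t : Term} : SN t ↔ Acc (fun s' s => Step s s') t := by
  rw [← not_iff_not, not_acc_iff_exists_descending_chain, SN, not_not]
  rfl

theorem Aff.acc {Γ : Env} {t : Term} {σ : Ty} {k : ℕ} (h : Aff Γ t (.ty σ) k) :
    Acc (fun s' s => Step s s') t := by
  induction k using Nat.strong_induction_on generalizing t with
  | _ k ih =>
    induction hw : piWeight t using Nat.strong_induction_on generalizing t with
    | _ w ihw =>
      refine Acc.intro t fun t' ht => ?_
      -- Lexicographic descent: a `β`-step may raise the weight but lowers the size; a `π`-step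
      -- keeps the size bounded and lowers the weight.
      have key : ∀ k', k' ≤ k → Aff Γ t' (.ty σ) k' → (k' < k ∨ piWeight t' < w) →
          Acc (fun s' s => Step s s') t' := by
        intro k' hk h' hor
        rcases hk.lt_or_eq with hlt | rfl
        · exact ih k' hlt h'
        · exact ihw _ (hor.resolve_left (lt_irrefl _)) h' rfl
      rcases ht with ht | ht
      · obtain ⟨k', hk, h'⟩ := Aff.betaStep ht h
        exact key k' (by omega) h' (Or.inl (by omega))
      · obtain ⟨k', hk, h'⟩ := Aff.piStep ht h
        exact key k' (by omega) h' (Or.inr (hw ▸ ht.piWeight_lt))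


/-! ### Typability of strongly normalizing terms -/

namespace Lin

theorem multi_induction {t : Term} {P : Env → Multiset Ty → ℕ → Prop} (nil : P 0 0 0)
    (cons : ∀ {Γ Δ : Env} {σ : Ty} {M : Multiset Ty} {k m : ℕ},
      Lin Γ t (.ty σ) k → P Δ M m → P (Γ + Δ) (σ ::ₘ M) (k + m))
    {Γ : Env} {M : Multiset Ty} {k : ℕ} (h : Lin Γ t (.multi M) k) : P Γ M k := by
  generalize hp : Pred.multi M = p at h
  induction h generalizing M with
  | var | lam | app => cases hp
  | nil => cases hp; exact nil
  | cons h _ _ ih => cases hp; exact cons h (ih cons rfl)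

theorem add {Γ Δ : Env} {t : Term} {M N : Multiset Ty} {k m : ℕ}
    (h : Lin Γ t (.multi M) k) (h' : Lin Δ t (.multi N) m) :
    Lin (Γ + Δ) t (.multi (M + N)) (k + m) := by
  refine multi_induction (P := fun Γ M k => Lin (Γ + Δ) t (.multi (M + N)) (k + m)) ?_ ?_ h
  · simpa using h'
  · intro Γ₁ Γ₂ σ M k₁ k₂ h₁ ih
    rw [Multiset.cons_add, add_assoc, add_assoc]
    exact Lin.cons h₁ ih

theorem singleton {Γ : Env} {t : Term} {σ : Ty} {k : ℕ} (h : Lin Γ t (.ty σ) k) :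
    Lin Γ t (.multi {σ}) k := by
  have := Lin.cons h (Lin.nil t)
  rwa [add_zero] at this

theorem exists_ty {Γ : Env} {t : Term} {M : Multiset Ty} {k : ℕ} (h : Lin Γ t (.multi M) k)
    (hM : M ≠ 0) : ∃ Γ σ k, Lin Γ t (.ty σ) k := by
  refine multi_induction (P := fun _ M _ => M ≠ 0 → ∃ Γ σ k, Lin Γ t (.ty σ) k) ?_ ?_ h hM
  · exact fun h => absurd rfl h
  · exact fun h _ _ => ⟨_, _, _, h⟩

theorem of_choice {Γ : Env} {t : Term} {M N : Multiset Ty} {k : ℕ} (hc : Choice M N)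
    (h : Lin Γ t (.multi N) k) :
    (∃ Γ k, Lin Γ t (.multi M) k) ∧ ∃ Γ σ k, Lin Γ t (.ty σ) k := by
  refine ⟨?_, h.exists_ty hc.ne_zero⟩
  rcases hc with ⟨-, rfl⟩ | ⟨rfl, -⟩
  · exact ⟨_, _, h⟩
  · exact ⟨_, _, Lin.nil t⟩

theorem exists_choice {Γ Δ : Env} {t : Term} {M : Multiset Ty} {σ : Ty} {k m : ℕ}
    (h : Lin Γ t (.multi M) k) (h' : Lin Δ t (.ty σ) m) :
    ∃ Γ N k, Choice M N ∧ Lin Γ t (.multi N) k := by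
  rcases eq_or_ne M 0 with rfl | hM
  · exact ⟨_, _, _, Or.inr ⟨rfl, σ, rfl⟩, h'.singleton⟩
  · exact ⟨_, _, _, Or.inl ⟨hM, rfl⟩, h⟩

/-! ### Inverting renaming and substitution in the exact system -/

theorem unrename_multi {ρ : ℕ → ℕ} {s t : Term}
    (H : ∀ {Γ : Env} {σ : Ty} {k : ℕ}, Lin Γ s (.ty σ) k →
      ∃ Δ, Γ = Env.push ρ Δ ∧ Lin Δ t (.ty σ) k)
    {Γ : Env} {M : Multiset Ty} {k : ℕ} (h : Lin Γ s (.multi M) k) :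
    ∃ Δ, Γ = Env.push ρ Δ ∧ Lin Δ t (.multi M) k := by
  refine multi_induction
    (P := fun Γ M k => ∃ Δ, Γ = Env.push ρ Δ ∧ Lin Δ t (.multi M) k) ?_ ?_ h
  · exact ⟨0, (Env.push_zero ρ).symm, Lin.nil t⟩
  · rintro _ _ σ M k m h₁ ⟨Δ₂, rfl, h₂⟩
    obtain ⟨Δ₁, rfl, h₃⟩ := H h₁
    exact ⟨Δ₁ + Δ₂, (Env.push_add _ _ _).symm, Lin.cons h₃ h₂⟩

theorem push_upRen_eq_cons {ρ : ℕ → ℕ} (hρ : ρ.Injective) {M : Multiset Ty} {Γ Δ : Env}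
    (h : Env.cons M Γ = Env.push (upRen ρ) Δ) :
    ∃ Δ', Δ = Env.cons M Δ' ∧ Γ = Env.push ρ Δ' := by
  rw [← Env.cons_tail Δ, Env.push_upRen hρ, Env.cons_inj] at h
  exact ⟨_, by rw [h.1, Env.cons_tail], h.2⟩

theorem unrename_ty {t : Term} {ρ : ℕ → ℕ} (hρ : ρ.Injective) {Γ : Env} {σ : Ty} {k : ℕ}
    (h : Lin Γ (rename ρ t) (.ty σ) k) : ∃ Δ, Γ = Env.push ρ Δ ∧ Lin Δ t (.ty σ) k := by
  induction t generalizing ρ Γ σ k with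
  | var n =>
    cases h with
    | var => exact ⟨_, (Env.push_single hρ n _).symm, Lin.var n σ⟩
  | lam t ih =>
    cases h with
    | lam h =>
      obtain ⟨Δ, e, h'⟩ := ih (Env.upRen_injective hρ) h
      obtain ⟨Δ', rfl, rfl⟩ := push_upRen_eq_cons hρ e
      exact ⟨Δ', rfl, Lin.lam h'⟩
  | app t u r iht ihu ihr =>
    cases h with
    | app hN hP h₁ h₂ h₃ =>
      obtain ⟨Γ', rfl, h₁'⟩ := unrename_multi (iht hρ) h₁
      obtain ⟨Δ', rfl, h₂'⟩ := unrename_multi (ihu hρ) h₂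
      obtain ⟨_, e, h₃'⟩ := ihr (Env.upRen_injective hρ) h₃
      obtain ⟨Λ', rfl, rfl⟩ := push_upRen_eq_cons hρ e
      exact ⟨Γ' + Δ' + Λ', by rw [Env.push_add, Env.push_add], Lin.app hN hP h₁' h₂' h₃'⟩

theorem unrename {t : Term} {ρ : ℕ → ℕ} (hρ : ρ.Injective) {Γ : Env} {p : Pred} {k : ℕ}
    (h : Lin Γ (rename ρ t) p k) : ∃ Δ, Γ = Env.push ρ Δ ∧ Lin Δ t p k := by
  cases p with
  | ty σ => exact h.unrename_ty hρ
  | multi M => exact unrename_multi (unrename_ty hρ) h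

theorem unrename_succ {t : Term} {Γ : Env} {p : Pred} {k : ℕ}
    (h : Lin Γ (rename Nat.succ t) p k) : ∃ Δ, Γ = Env.cons 0 Δ ∧ Lin Δ t p k := by
  obtain ⟨Δ, rfl, h'⟩ := h.unrename Nat.succ_injective
  exact ⟨Δ, Env.push_succ Δ, h'⟩

/-- A derivation for a substitution instance consists of derivations for the parts. -/
def Unsubst (c : ℕ) (u t : Term) (Γ : Env) (p : Pred) : Prop :=
  ∃ Γ' Δ k m, Γ = Γ' ∘ skip c + Δ ∧ Lin Γ' t p k ∧ Lin Δ u (.multi (Γ' c)) m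

theorem unsubst_multi {c : ℕ} {u s t : Term}
    (H : ∀ {Γ : Env} {σ : Ty} {k : ℕ}, Lin Γ s (.ty σ) k → Unsubst c u t Γ (.ty σ))
    {Γ : Env} {M : Multiset Ty} {k : ℕ} (h : Lin Γ s (.multi M) k) :
    Unsubst c u t Γ (.multi M) := by
  refine multi_induction (P := fun Γ M _ => Unsubst c u t Γ (.multi M)) ?_ ?_ h
  · exact ⟨0, 0, 0, 0, (add_zero _).symm, Lin.nil t, Lin.nil u⟩
  · rintro _ _ σ M _ _ h₁ ⟨Γ₂, Δ₂, k₂, m₂, rfl, h₂, hu₂⟩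
    obtain ⟨Γ₁, Δ₁, k₁, m₁, rfl, h₁, hu₁⟩ := H h₁
    exact ⟨Γ₁ + Γ₂, Δ₁ + Δ₂, _, _, add_add_add_comm _ _ _ _, Lin.cons h₁ h₂, hu₁.add hu₂⟩

/-- By exactness the weakened `u` makes no use of the new variable, so all of `M` goes to `t`. -/
theorem Unsubst.cons {c : ℕ} {u t : Term} {M : Multiset Ty} {Γ : Env} {p : Pred}
    (h : Unsubst (c + 1) (rename Nat.succ u) t (Env.cons M Γ) p) :
    ∃ Γ' Δ k m, Γ = Γ' ∘ skip c + Δ ∧ Lin (Env.cons M Γ') t p k ∧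
      Lin Δ u (.multi (Γ' c)) m := by
  obtain ⟨Γ', Δ, k, m, e, h, hu⟩ := h
  obtain ⟨Δ, rfl, hu'⟩ := hu.unrename_succ
  rw [← Env.cons_tail Γ'] at e h
  rw [cons_comp_skip, Env.cons_zero_add, Env.cons_inj] at e
  obtain ⟨rfl, rfl⟩ := e
  exact ⟨_, Δ, k, m, rfl, h, hu'⟩

theorem unsubst {t : Term} {c : ℕ} {u : Term} {θ : ℕ → Term} (hθ : Single c u θ)
    {Γ : Env} {σ : Ty} {k : ℕ} (h : Lin Γ (subst θ t) (.ty σ) k) :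
    Unsubst c u t Γ (.ty σ) := by
  induction t generalizing c u θ Γ σ k with
  | var n =>
    rcases eq_or_skip c n with rfl | ⟨n, rfl⟩
    · rw [subst, hθ.1] at h
      refine ⟨Pi.single n {σ}, Γ, 1, k, ?_, Lin.var n σ, ?_⟩
      · rw [single_comp_skip, zero_add]
      · rw [Pi.single_eq_same]; exact h.singleton
    · rw [subst, hθ.2] at h
      cases h with
      | var =>
        refine ⟨Pi.single (skip c n) {σ}, 0, 1, 0, ?_, Lin.var _ σ, ?_⟩
        · rw [single_skip_comp_skip, add_zero]
        · rw [Pi.single_eq_of_ne (skip_ne c n).symm]; exact Lin.nil u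
  | lam t ih =>
    cases h with
    | lam h =>
      obtain ⟨Γ', Δ, k, m, rfl, h, hu⟩ := (ih hθ.up h).cons
      exact ⟨Γ', Δ, _, m, rfl, Lin.lam h, hu⟩
  | app t s r iht ihs ihr =>
    cases h with
    | app hN hP h₁ h₂ h₃ =>
      obtain ⟨Γ₁, Δ₁, _, _, rfl, h₁, hu₁⟩ := unsubst_multi (iht hθ) h₁
      obtain ⟨Γ₂, Δ₂, _, _, rfl, h₂, hu₂⟩ := unsubst_multi (ihs hθ) h₂
      obtain ⟨Γ₃, Δ₃, _, _, rfl, h₃, hu₃⟩ := (ihr hθ.up h₃).cons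
      refine ⟨Γ₁ + Γ₂ + Γ₃, Δ₁ + Δ₂ + Δ₃, _, _, ?_, Lin.app hN hP h₁ h₂ h₃,
        (hu₁.add hu₂).add hu₃⟩
      rw [add_add_add_comm (_ ∘ _), add_add_add_comm (_ + _)]
      rfl

theorem uninst {Γ : Env} {t u : Term} {σ : Ty} {k : ℕ} (h : Lin Γ (inst u t) (.ty σ) k) :
    ∃ Δ Λ M k m, Lin (Env.cons M Δ) t (.ty σ) k ∧ Lin Λ u (.multi M) m := by
  obtain ⟨Γ', Λ, k, m, -, h, hu⟩ := unsubst (c := 0) ⟨rfl, fun _ => rfl⟩ h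
  rw [← Env.cons_tail Γ'] at h
  exact ⟨_, Λ, _, k, m, h, hu⟩

/-- Each derivation of the instance determines the multiset of types at which it uses `u`; this
multiset becomes the domain of an arrow for the abstraction. -/
theorem uninst_multi {Γ : Env} {t u : Term} {B : Multiset Ty} {k : ℕ}
    (h : Lin Γ (inst u t) (.multi B) k) :
    ∃ A Δ Λ k m, codomains A = B ∧ Lin Δ (Term.lam t) (.multi (arrows A)) k ∧
      Lin Λ u (.multi (domains A)) m := by
  refine multi_induction (P := fun _ B _ => ∃ A Δ Λ k m, codomains A = B ∧
    Lin Δ (Term.lam t) (.multi (arrows A)) k ∧ Lin Λ u (.multi (domains A)) m) ?_ ?_ h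
  · exact ⟨0, 0, 0, 0, 0, rfl, Lin.nil _, Lin.nil _⟩
  · rintro _ _ σ _ _ _ h₁ ⟨A, Δ₂, Λ₂, k₂, m₂, rfl, h₂, hu₂⟩
    obtain ⟨Δ₁, Λ₁, M, k₁, m₁, h₁, hu₁⟩ := h₁.uninst
    refine ⟨(M, σ) ::ₘ A, Δ₁ + Δ₂, Λ₁ + Λ₂, k₁ + 1 + k₂, m₁ + m₂, by simp, ?_, ?_⟩
    · rw [arrows_cons]; exact Lin.cons (Lin.lam h₁) h₂
    · rw [domains_cons]; exact hu₁.add hu₂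

end Lin

/-! ### Expansion, and typability of strongly normalizing terms -/

theorem typable_iff {t : Term} : Typable t ↔ ∃ Γ σ k, Lin Γ t (.ty σ) k := by
  simp only [Typable, typing_iff]

theorem Typable.lam {t : Term} (h : Typable t) : Typable (lam t) := by
  rw [typable_iff] at *
  obtain ⟨Γ, σ, k, h⟩ := h
  rw [← Env.cons_tail Γ] at h
  exact ⟨_, _, _, Lin.lam h⟩

theorem Typable.of_lam {t : Term} (h : Typable (Term.lam t)) : Typable t := by
  rw [typable_iff] at *
  obtain ⟨Γ, σ, k, h⟩ := h
  cases h with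
  | lam h => exact ⟨_, _, _, h⟩

/-- Typability of `t` and `u` supplies the witnesses of `#` where the needed multiset is empty. This
may change their environments, while that of the body stays fixed. -/
theorem typable_app {A : Multiset (Multiset Ty × Ty)} {Γ Δ Λ : Env} {t u r : Term} {σ : Ty}
    {k₁ k₂ k₃ : ℕ} (h₁ : Lin Γ t (.multi (arrows A)) k₁) (ht : Typable t)
    (h₂ : Lin Δ u (.multi (domains A)) k₂) (hu : Typable u)
    (h₃ : Lin (Env.cons (codomains A) Λ) r (.ty σ) k₃) :
    ∃ Γ' Δ' k, Lin (Γ' + Δ' + Λ) (app t u r) (.ty σ) k := by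
  rw [typable_iff] at *
  obtain ⟨_, _, _, ht⟩ := ht
  obtain ⟨_, _, _, hu⟩ := hu
  obtain ⟨_, _, _, hN, h₁⟩ := h₁.exists_choice ht
  obtain ⟨_, _, _, hP, h₂⟩ := h₂.exists_choice hu
  exact ⟨_, _, _, Lin.app hN hP h₁ h₂ h₃⟩

theorem Typable.app_var {x : ℕ} {u r : Term} (hu : Typable u) (hr : Typable r) :
    Typable (app (var x) u r) := by
  obtain ⟨Γ, σ, k, h⟩ := typable_iff.1 hr
  rw [← Env.cons_tail Γ] at h
  -- A variable can have any type, so it takes [ ] → τ for each type τ of the bound variable; `u`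
  -- then only needs a witness type.
  have hx : ∀ B : Multiset Ty, ∃ A Δ m, codomains A = B ∧ domains A = 0 ∧
      Lin Δ (var x) (.multi (arrows A)) m := by
    intro B
    induction B using Multiset.induction with
    | empty => exact ⟨0, 0, 0, rfl, rfl, Lin.nil _⟩
    | cons τ B ih =>
      obtain ⟨A, Δ, m, rfl, hA, h⟩ := ih
      refine ⟨(0, τ) ::ₘ A, Pi.single x {Ty.arrow 0 τ} + Δ, 1 + m, by simp, by simp [hA], ?_⟩
      rw [arrows_cons]
      exact Lin.cons (Lin.var x _) h
  obtain ⟨A, Δ, m, hA, hA', hx⟩ := hx (Γ 0)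
  rw [← hA] at h
  have hxt : Typable (var x) := ⟨_, Ty.base 0, _, Der.var x _⟩
  obtain ⟨_, _, _, h⟩ := typable_app hx hxt (hA' ▸ Lin.nil u) hu h
  exact typable_iff.2 ⟨_, _, _, h⟩

theorem Typable.beta_expansion {t u r : Term} (ht : Typable t) (hu : Typable u)
    (h : Typable (inst (inst u t) r)) : Typable (app (Term.lam t) u r) := by
  obtain ⟨_, _, _, h⟩ := typable_iff.1 h
  obtain ⟨_, _, _, _, _, hr, hs⟩ := h.uninst
  obtain ⟨A, _, _, _, _, rfl, h₁, h₂⟩ := hs.uninst_multi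
  obtain ⟨_, _, _, h⟩ := typable_app h₁ ht.lam h₂ hu hr
  exact typable_iff.2 ⟨_, _, _, h⟩

/-- Each derivation of `r` takes the part of `A` that matches its own use of the bound variable, and
receives its own application node. A derivation whose part is empty falls back on the typability of
`t` and `u`. -/
theorem app_multi_expansion {t u r : Term} (ht : Typable t) (hu : Typable u)
    {Γ : Env} {N : Multiset Ty} {k : ℕ} (h : Lin Γ r (.multi N) k)
    {A : Multiset (Multiset Ty × Ty)} (hA : codomains A = Γ 0)
    (ht' : ∀ {A'}, A' ≤ A → ∃ Δ m, Lin Δ t (.multi (arrows A')) m)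
    (hu' : ∀ {A'}, A' ≤ A → ∃ Δ m, Lin Δ u (.multi (domains A')) m) :
    ∃ Δ m, Lin Δ (app t u r) (.multi N) m := by
  revert A
  refine Lin.multi_induction (P := fun Γ N _ => ∀ {A : Multiset (Multiset Ty × Ty)},
    codomains A = Γ 0 → (∀ {A'}, A' ≤ A → ∃ Δ m, Lin Δ t (.multi (arrows A')) m) →
    (∀ {A'}, A' ≤ A → ∃ Δ m, Lin Δ u (.multi (domains A')) m) →
    ∃ Δ m, Lin Δ (app t u r) (.multi N) m) ?_ ?_ h
  · exact fun _ _ _ => ⟨0, 0, Lin.nil _⟩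
  · intro Γ₁ Γ₂ σ N k₁ k₂ h₁ ih A hA ht' hu'
    obtain ⟨A₁, A₂, rfl, hA₁, hA₂⟩ := codomains_eq_add hA
    obtain ⟨_, _, h₃⟩ := ih hA₂ (fun h => ht' (h.trans le_add_self))
      (fun h => hu' (h.trans le_add_self))
    obtain ⟨_, _, ht₁⟩ := ht' (Multiset.le_add_right A₁ A₂)
    obtain ⟨_, _, hu₁⟩ := hu' (Multiset.le_add_right A₁ A₂)
    rw [← Env.cons_tail Γ₁, ← hA₁] at h₁
    obtain ⟨_, _, _, h₄⟩ := typable_app ht₁ ht hu₁ hu h₁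
    exact ⟨_, _, Lin.cons h₄ h₃⟩

theorem Lin.multi_of_le {t : Term} {M N : Multiset Ty} {Γ : Env} {k : ℕ}
    (h : Lin Γ t (.multi N) k) (hM : M ≤ N) : ∃ Δ m, Lin Δ t (.multi M) m := by
  classical
  have key : ∀ σ ∈ N, ∃ Δ m, Lin Δ t (.ty σ) m := by
    refine Lin.multi_induction (P := fun _ N _ => ∀ σ ∈ N, ∃ Δ m, Lin Δ t (.ty σ) m) ?_ ?_ h
    · simp
    · intro Γ₁ Γ₂ τ N k₁ k₂ h₁ ih σ hσ
      rcases Multiset.mem_cons.1 hσ with rfl | hσ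
      · exact ⟨_, _, h₁⟩
      · exact ih σ hσ
  replace key : ∀ σ ∈ M, ∃ Δ m, Lin Δ t (.ty σ) m :=
    fun σ hσ => key σ (Multiset.mem_of_le hM hσ)
  clear hM
  induction M using Multiset.induction with
  | empty => exact ⟨0, 0, Lin.nil t⟩
  | cons σ M ih =>
    obtain ⟨_, _, h₁⟩ := key σ (Multiset.mem_cons_self σ M)
    obtain ⟨_, _, h₂⟩ := ih fun τ hτ => key τ (Multiset.mem_cons_of_mem hτ)
    exact ⟨_, _, Lin.cons h₁ h₂⟩

theorem Typable.pi_expansion {t u r u' r' : Term}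
    (h : Typable (app t u (app r (rename Nat.succ u') (rename (upRen Nat.succ) r')))) :
    Typable (app (app t u r) u' r') := by
  obtain ⟨_, _, _, h⟩ := typable_iff.1 h
  generalize hb : app r (rename Nat.succ u') (rename (upRen Nat.succ) r') = b at h
  cases h with
  | @app A _ _ Γ Δ Λ _ _ _ _ _ _ _ hN hP h₁ h₂ h₃ =>
    subst hb
    obtain ⟨⟨_, _, ht'⟩, ht⟩ := h₁.of_choice hN
    obtain ⟨⟨_, _, hu'⟩, hu⟩ := h₂.of_choice hP
    generalize hE : Env.cons (codomains A) Λ = E at h₃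
    cases h₃ with
    | @app A' N' P' Γ' Δ' Λ' _ _ _ _ _ _ _ hN' hP' h₄ h₅ h₆ =>
      obtain ⟨Δ', rfl, h₅'⟩ := h₅.unrename_succ
      obtain ⟨_, e, h₆'⟩ := h₆.unrename (Env.upRen_injective Nat.succ_injective)
      obtain ⟨Λ', rfl, rfl⟩ := Lin.push_upRen_eq_cons Nat.succ_injective e
      -- The weakened `u'` and `r'` do not use the bound variable, so all its types go to `r`.
      have hA : codomains A = Γ' 0 := by
        have := congrFun hE 0
        simpa [Env.push_succ] using this
      obtain ⟨_, _, h₇⟩ := app_multi_expansion (typable_iff.2 ht) (typable_iff.2 hu) h₄ hA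
        (fun h => ht'.multi_of_le (Multiset.map_le_map h))
        (fun h => hu'.multi_of_le (by
          obtain ⟨C, rfl⟩ := Multiset.le_iff_exists_add.1 h
          rw [domains_add]
          exact Multiset.le_add_right _ _))
      exact typable_iff.2 ⟨_, _, _, Lin.app hN' hP' h₇ h₅' h₆'⟩

/-- The subterm relation. -/
inductive Sub : Term → Term → Prop
  | refl (t : Term) : Sub t t
  | lam {s t : Term} : Sub s t → Sub s (lam t)
  | appFun {s t : Term} (u r : Term) : Sub s t → Sub s (app t u r)
  | appArg {s u : Term} (t r : Term) : Sub s u → Sub s (app t u r)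
  | appBody {s r : Term} (t u : Term) : Sub s r → Sub s (app t u r)

theorem Sub.trans {s t v : Term} (h : Sub s t) (h' : Sub t v) : Sub s v := by
  induction h' with
  | refl => exact h
  | lam _ ih => exact Sub.lam ih
  | appFun u r _ ih => exact Sub.appFun u r ih
  | appArg t r _ ih => exact Sub.appArg t r ih
  | appBody t u _ ih => exact Sub.appBody t u ih

theorem Sub.compat {R : Term → Term → Prop} {s s' t : Term} (h : Sub s t) (hs : Compat R s s') :
    ∃ t', Compat R t t' ∧ Sub s' t' := by
  induction h with
  | refl => exact ⟨s', hs, Sub.refl s'⟩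
  | lam _ ih =>
    obtain ⟨t', h, h'⟩ := ih
    exact ⟨_, Compat.lam h, Sub.lam h'⟩
  | appFun u r _ ih =>
    obtain ⟨t', h, h'⟩ := ih
    exact ⟨_, Compat.appFun u r h, Sub.appFun u r h'⟩
  | appArg t r _ ih =>
    obtain ⟨t', h, h'⟩ := ih
    exact ⟨_, Compat.appArg t r h, Sub.appArg t r h'⟩
  | appBody t u _ ih =>
    obtain ⟨t', h, h'⟩ := ih
    exact ⟨_, Compat.appBody t u h, Sub.appBody t u h'⟩

/-- Quantifying over subterms lets a step inside `s` be replayed in `t`, where the outer induction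
applies, while the inner structural induction types the parts of `s`. The latter is needed for
erased arguments, of which the reduct keeps no trace. The head of an application is a variable, an
abstraction or an application, and the last two cases are root redexes. -/
theorem typable_of_acc {t : Term} (h : Acc (fun s' s => Step s s') t) :
    ∀ s, Sub s t → Typable s := by
  induction h with
  | intro t _ ih =>
    intro s hs
    have hstep : ∀ {v v'}, Sub v t → Step v v' → Typable v' := by
      rintro v v' hv (h | h)
      · obtain ⟨t', h, h'⟩ := hv.compat h
        exact ih t' (Or.inl h) v' h'
      · obtain ⟨t', h, h'⟩ := hv.compat h
        exact ih t' (Or.inr h) v' h'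
    induction s with
    | var n => exact ⟨_, Ty.base 0, _, Der.var n _⟩
    | lam s ihs => exact (ihs ((Sub.lam (Sub.refl s)).trans hs)).lam
    | app v u r ihv ihu ihr =>
      have hv := ihv ((Sub.appFun u r (Sub.refl v)).trans hs)
      have hu := ihu ((Sub.appArg v r (Sub.refl u)).trans hs)
      have hr := ihr ((Sub.appBody v u (Sub.refl r)).trans hs)
      cases v with
      | var x => exact hu.app_var hr
      | lam w =>
        exact hv.of_lam.beta_expansion hu (hstep hs (Or.inl (Compat.root (BetaRoot.mk w u r))))
      | app t₁ u₁ r₁ =>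
        exact Typable.pi_expansion (hstep hs (Or.inr (Compat.root (PiRoot.mk t₁ u₁ r₁ u r))))

/-! ### Failure of quantitative subject reduction for `π` -/

/-- The number of variable occurrences, abstractions and applications of a term. -/
def size : Term → ℕ
  | var _ => 1
  | lam t => size t + 1
  | app t u r => size t + size u + size r + 1

/-- Both premises `t` and `u` of an application carry non-empty multisets, so every node of the term
is visited at least once. -/
theorem Lin.size_le {Γ : Env} {t : Term} {p : Pred} {k : ℕ} (h : Lin Γ t p k) :
    p ≠ .multi 0 → size t ≤ k := by
  induction h with
  | var => exact fun _ => le_rfl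
  | lam _ ih => exact fun _ => Nat.succ_le_succ (ih (by simp))
  | nil => exact fun h => absurd rfl h
  | cons _ _ ih _ => exact fun _ => (ih (by simp)).trans (Nat.le_add_right _ _)
  | app hN hP _ _ _ ih₁ ih₂ ih₃ =>
    intro _
    have h₁ := ih₁ (by simpa using hN.ne_zero)
    have h₂ := ih₂ (by simpa using hP.ne_zero)
    have h₃ := ih₃ (by simp)
    simp only [size]
    omega

/-- An application with a variable as its head and its argument, whose bound variable does not
occur. -/
theorem Lin.app_erasing {x y : ℕ} {r : Term} {Γ : Env} {σ : Ty} {k : ℕ} (a : Ty)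
    (h : Lin (Env.cons 0 Γ) r (.ty σ) k) :
    Lin (Pi.single x {a} + Pi.single y {a} + Γ) (Term.app (Term.var x) (Term.var y) r) (.ty σ)
      (1 + 1 + k + 1) :=
  Lin.app (A := 0) (Or.inr ⟨rfl, a, rfl⟩) (Or.inr ⟨rfl, a, rfl⟩)
    (Lin.var x a).singleton (Lin.var y a).singleton h

theorem cons_zero_single (x : ℕ) (M : Multiset Ty) :
    Env.cons 0 (Pi.single x M) = Pi.single (x + 1) M := by
  rw [← Env.push_succ, Env.push_single Nat.succ_injective]

/-- The body does not use the bound variable, so no arrows are required and `#` forces exactly one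
type for the head. By exactness it is the only contribution to `x`. -/
theorem Lin.app_var_single {x : ℕ} {Γ : Env} {σ : Ty} {k : ℕ} {u r : Term}
    (h : Lin Γ (Term.app (Term.var x) u (rename Nat.succ r)) (.ty σ) k)
    (hu : ∀ {Δ p m}, Lin Δ u p m → Δ x = 0) (hr : ∀ {Δ p m}, Lin Δ r p m → Δ x = 0) :
    (Γ x).card = 1 := by
  generalize hs : rename Nat.succ r = s at h
  cases h with
  | @app A N P Γ Δ Λ _ _ _ _ _ _ _ hN hP h₁ h₂ h₃ =>
    subst hs
    obtain ⟨Λ', e, h₃'⟩ := h₃.unrename_succ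
    obtain ⟨hA, rfl⟩ := Env.cons_inj.1 e
    obtain rfl : A = 0 := Multiset.map_eq_zero.1 hA
    rcases hN with ⟨h, -⟩ | ⟨-, τ, rfl⟩
    · exact absurd rfl h
    have hx : ∀ {Γ : Env} {N : Multiset Ty} {k : ℕ}, Lin Γ (Term.var x) (.multi N) k → Γ x = N := by
      intro Γ N k h
      refine Lin.multi_induction (P := fun Γ N _ => Γ x = N) rfl ?_ h
      intro Γ₁ Γ₂ σ N k₁ k₂ h₁ ih
      cases h₁ with
      | var => simp [ih]
    simp [hx h₁, hu h₂, hr h₃']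

theorem Lin.rename_apply_eq_zero {t : Term} {ρ : ℕ → ℕ} (hρ : ρ.Injective) {Γ : Env} {p : Pred}
    {k x : ℕ} (hx : ∀ n, ρ n ≠ x) (h : Lin Γ (rename ρ t) p k) : Γ x = 0 := by
  obtain ⟨Δ, rfl, -⟩ := h.unrename hρ
  exact Env.push_eq_zero Δ hx

/-- In x(x, y.x)(x, y.x) every application is erasing, so a derivation can visit each node exactly
once and have the size 7 of the term. The reduct x(x, y.x(x, y.x)) also has 7 nodes, and no
derivation is smaller than its term. -/
theorem pi_size_example : ∃ (Γ : Env) (t t' : Term) (σ : Ty) (k : ℕ),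
    Typing Γ t σ k ∧ PiStep t t' ∧
      ∀ (Γ' : Env) (σ' : Ty) (k' : ℕ), Typing Γ' t' σ' k' → k ≤ k' := by
  have h₁ := Lin.app_erasing (x := 0) (y := 0) (r := var 1) (Γ := Pi.single 0 {Ty.base 0})
    (Ty.base 0) (by rw [cons_zero_single]; exact Lin.var 1 _)
  have h₂ := Lin.app (A := 0) (Or.inr ⟨rfl, Ty.base 0, rfl⟩) (Or.inr ⟨rfl, Ty.base 0, rfl⟩)
    h₁.singleton (Lin.var 0 (Ty.base 0)).singleton
    (Λ := Pi.single 0 {Ty.base 0}) (by rw [codomains_zero, cons_zero_single]; exact Lin.var 1 _)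
  refine ⟨_, _, _, _, _, typing_iff.2 h₂, Compat.root (PiRoot.mk _ _ _ _ _), ?_⟩
  intro Γ' σ' k' h
  exact (typing_iff.1 h).size_le (by simp)

/-- In the source the inner application is typed twice, and its head once for each of these
derivations; in the target a single derivation of the head suffices. -/
theorem pi_env_example : ∃ (Γ : Env) (t t' : Term) (σ : Ty) (k : ℕ),
    Typing Γ t σ k ∧ PiStep t t' ∧ ∀ k' : ℕ, ¬ Typing Γ t' σ k' := by
  set a := Ty.base 0
  have h₁ := Lin.app_erasing (x := 0) (y := 1) (r := var 2) (Γ := Pi.single 1 {Ty.arrow 0 a}) a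
    (by rw [cons_zero_single]; exact Lin.var 2 _)
  have h₂ := Lin.app_erasing (x := 0) (y := 0) (r := var 3) (Γ := Pi.single 2 {a}) a
    (by rw [cons_zero_single]; exact Lin.var 3 _)
  -- The source is x(y, v.y)(y, w.w(w, v.y)), with x and y the free variables 0 and 1. The two
  -- occurrences of w force two derivations of x(y, v.y), so x receives two types.
  have h₃ := Lin.app (A := {(0, a), (0, a)}) (N := {Ty.arrow 0 a, Ty.arrow 0 a})
    (Or.inl ⟨by simp [arrows], by simp [arrows]⟩)
    (Or.inr ⟨by simp [domains], a, rfl⟩) (Lin.cons h₁ h₁.singleton)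
    (Lin.var 1 a).singleton (Λ := Pi.single 1 {a}) (r := app (var 0) (var 0) (var 3)) (σ := a)
    (k₃ := 1 + 1 + 1 + 1) (by
      convert h₂ using 1
      funext n
      rcases n with _ | _ | n
      · simp [codomains]
      · simp
      · simp [Pi.single_apply])
  refine ⟨_, _, _, _, _, typing_iff.2 h₃, Compat.root (PiRoot.mk _ _ _ _ _), fun k' h => ?_⟩
  -- The reduct is x(y, v.y(y, w.w(w, v.y))). Neither its argument nor its body contains x, as both
  -- are renamings along the successor, so x would have exactly one type.
  have := (typing_iff.1 h).app_var_single
    (r := app (var 1) (var 1) (app (var 0) (var 0) (var 3)))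
    (fun h => h.rename_apply_eq_zero (t := var 0) (ρ := Nat.succ) Nat.succ_injective
      (by simp))
    (fun h => h.rename_apply_eq_zero
      (t := app (var 0) (var 0) (app (var 0) (var 0) (var 2)))
      (ρ := Nat.succ) Nat.succ_injective (by simp))
  simp at this

end GenApp

open GenApp

theorem mainTheorem7 :
    (∀ (Γ : Env) (t : Term) (σ : Ty) (k : ℕ), Typing Γ t σ k →
      (∀ (n : ℕ) (t' : Term), RedSeq t n t' → n ≤ k) ∧ SN t) ∧
    (∃ (Γ : Env) (t t' : Term) (σ : Ty) (k : ℕ),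
      Typing Γ t σ k ∧ PiStep t t' ∧ ∀ k' : ℕ, ¬ Typing Γ t' σ k') ∧
    (∃ (Γ : Env) (t t' : Term) (σ : Ty) (k : ℕ),
      Typing Γ t σ k ∧ PiStep t t' ∧
        ∀ (Γ' : Env) (σ' : Ty) (k' : ℕ), Typing Γ' t' σ' k' → k ≤ k') ∧
    (∀ t : Term, SN t ↔ Typable t) := by
  have h₁ : ∀ (Γ : Env) (t : Term) (σ : Ty) (k : ℕ), Typing Γ t σ k →
      (∀ (n : ℕ) (t' : Term), RedSeq t n t' → n ≤ k) ∧ SN t := fun Γ t σ k h =>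
    have ha := (typing_iff.1 h).aff
    ⟨fun _ _ hs => Aff.redSeq_le hs ha, sn_iff_acc.2 ha.acc⟩
  refine ⟨h₁, pi_env_example, pi_size_example, fun t => ⟨fun h => ?_, ?_⟩⟩
  · exact typable_of_acc (sn_iff_acc.1 h) t (Sub.refl t)
  · rintro ⟨Γ, σ, k, h⟩
    exact (h₁ Γ t σ k h).2
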